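/- **Theorem 1.4.** Let $k>3$ and $n=k(k+1)/2$. Let $\mathcal F=\{f_1,\dots,f_n\}\subset\mathbb R^k$ be a maximal unit $(n,k)$ equiangular tight frame: $\mathcal F$ spans $\mathbb R^k$, $\|f_i\|=1$ for all $i$, there is $c\in(0,1)$ with $|\langle f_i,f_j\rangle|=c$ for all $i\ne j$, and there is $\gamma>0$ with $\|x\|^2=\gamma\sum_{i=1}^n\langle f_i,x\rangle^2$ for all $x\in\mathbb R^k$. Let $\Lambda=\Lambda(\mathcal F)=\left\{\sum_{i=1}^n a_if_i: a_i\in\mathbb Z\right\}$ and $|\Lambda|=\inf\{\|x\|: 0\ne x\in\Lambda\}$, and assume that $|\Lambda|=1$. Then $\Lambda$ is a full-rank lattice in $\mathbb R^k$, and, with $S(\Lambda)=\{x\in\Lambda:\|x\|=|\Lambda|\}$ its finite set of minimal vectors: 1. $\Lambda$ is perfect, i.e. the matrices $xx^\top$, $x\in S(\Lambda)$, span the space of real symmetric $k\times k$ matrices; 2. $\Lambda$ is eutactic, i.e. there are $c_x>0$ with $\|y\|^2=\sum_{x\in S(\Lambda)}c_x\langle y,x\rangle^2$ for all $y\in\mathbb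 R^k$; and it is even strongly eutactic, i.e. all the $c_x$ can be taken equal; 3. hence $\Lambda$ is extreme, i.e. the packing density $L\mapsto \mathrm{vol}\big(B(0,|L|/2)\big)/\det L$ (where $B(0,r)$ is the ball of radius $r$ and $\det L$ is the volume of a fundamental domain of $L$) has a local maximum at $\Lambda$ on the space of full-rank lattices of $\mathbb R^k$; equivalently, $g\mapsto \mathrm{vol}\big(B(0,|g\Lambda|/2)\big)/\det (g\Lambda)$ has a local maximum at the identity on $GL_k(\mathbb R)$. -/

import Mathlib

noncomputable section

/-- The family `f 0, …, f (n-1)` in `ℝ^k` is an `(n,k)` tight frame: `n > k`, the vectors span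
`ℝ^k`, and `‖x‖² = γ ∑ i, ⟨f i, x⟩²` for all `x`, with a constant `γ > 0`. -/
def IsTightFrame {n k : ℕ} (f : Fin n → EuclideanSpace ℝ (Fin k)) : Prop :=
  k < n ∧ Submodule.span ℝ (Set.range f) = ⊤ ∧
    ∃ γ : ℝ, 0 < γ ∧ ∀ x : EuclideanSpace ℝ (Fin k), ‖x‖ ^ 2 = γ * ∑ i, inner ℝ (f i) x ^ 2

/-- A unit `(n,k)` equiangular tight frame (ETF), of some angle `c ∈ (0,1)`. -/
def IsUnitETF {n k : ℕ} (f : Fin n → EuclideanSpace ℝ (Fin k)) : Prop :=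
  IsTightFrame f ∧ (∀ i, ‖f i‖ = 1) ∧
    ∃ c : ℝ, 0 < c ∧ c < 1 ∧ ∀ i j, i ≠ j → |inner ℝ (f i) (f j)| = c

/-- A unit `(n,k)` ETF attaining Gerzon's upper bound `n ≤ k(k+1)/2`. -/
def IsMaximalUnitETF {n k : ℕ} (f : Fin n → EuclideanSpace ℝ (Fin k)) : Prop :=
  IsUnitETF f ∧ 2 * n = k * (k + 1)

/-- `Λ(F)`: the set of all integer linear combinations of the vectors `f i`. -/
def integralSpan {n k : ℕ} (f : Fin n → EuclideanSpace ℝ (Fin k)) :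
    Submodule ℤ (EuclideanSpace ℝ (Fin k)) :=
  Submodule.span ℤ (Set.range f)

/-- `Λ` is a (full-rank) lattice in `ℝ^k`: discrete and spanning `ℝ^k` over `ℝ`. -/
def IsLattice {k : ℕ} (Λ : Submodule ℤ (EuclideanSpace ℝ (Fin k))) : Prop :=
  DiscreteTopology Λ ∧ Submodule.span ℝ (Λ : Set (EuclideanSpace ℝ (Fin k))) = ⊤

/-- The minimal norm `|Λ|`: the infimum (for a nonzero lattice, the minimum) of the norms of the
nonzero elements of `Λ`. -/
def minNorm {k : ℕ} (Λ : Submodule ℤ (EuclideanSpace ℝ (Fin k))) : ℝ :=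
  sInf {r : ℝ | ∃ x ∈ Λ, x ≠ 0 ∧ ‖x‖ = r}

/-- The set `S(Λ)` of minimal vectors of `Λ`. -/
def minVectors {k : ℕ} (Λ : Submodule ℤ (EuclideanSpace ℝ (Fin k))) :
    Set (EuclideanSpace ℝ (Fin k)) :=
  {x | x ∈ Λ ∧ ‖x‖ = minNorm Λ}

/-- A finite set of vectors is eutactic if it admits positive eutaxy coefficients. -/
def IsEutacticSet {k : ℕ} (X : Finset (EuclideanSpace ℝ (Fin k))) : Prop :=
  ∃ c : EuclideanSpace ℝ (Fin k) → ℝ, (∀ x ∈ X, 0 < c x) ∧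
    ∀ y : EuclideanSpace ℝ (Fin k), ‖y‖ ^ 2 = ∑ x ∈ X, c x * inner ℝ y x ^ 2

/-- A finite set of vectors is strongly eutactic if it admits equal positive eutaxy
coefficients. -/
def IsStronglyEutacticSet {k : ℕ} (X : Finset (EuclideanSpace ℝ (Fin k))) : Prop :=
  ∃ c : ℝ, 0 < c ∧
    ∀ y : EuclideanSpace ℝ (Fin k), ‖y‖ ^ 2 = ∑ x ∈ X, c * inner ℝ y x ^ 2

/-- A finite set of vectors is perfect if the matrices `x xᵀ` span the space of all real
symmetric `k × k` matrices. -/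
def IsPerfectSet {k : ℕ} (X : Finset (EuclideanSpace ℝ (Fin k))) : Prop :=
  (Submodule.span ℝ {A : Matrix (Fin k) (Fin k) ℝ | ∃ x ∈ X, A = Matrix.vecMulVec x x} :
      Set (Matrix (Fin k) (Fin k) ℝ)) = {A | A.IsSymm}

/-- A lattice is eutactic if its (finite) set of minimal vectors is. -/
def IsEutacticLattice {k : ℕ} (Λ : Submodule ℤ (EuclideanSpace ℝ (Fin k))) : Prop :=
  ∃ X : Finset (EuclideanSpace ℝ (Fin k)), (X : Set _) = minVectors Λ ∧ IsEutacticSet X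

/-- A lattice is strongly eutactic if its (finite) set of minimal vectors is. -/
def IsStronglyEutacticLattice {k : ℕ} (Λ : Submodule ℤ (EuclideanSpace ℝ (Fin k))) : Prop :=
  ∃ X : Finset (EuclideanSpace ℝ (Fin k)), (X : Set _) = minVectors Λ ∧ IsStronglyEutacticSet X

/-- A lattice is perfect if its (finite) set of minimal vectors is. -/
def IsPerfectLattice {k : ℕ} (Λ : Submodule ℤ (EuclideanSpace ℝ (Fin k))) : Prop :=
  ∃ X : Finset (EuclideanSpace ℝ (Fin k)), (X : Set _) = minVectors Λ ∧ IsPerfectSet X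

/-- The density of the packing of balls of radius `|Λ|/2` centred at the points of the lattice
`Λ`: the volume of one ball divided by the covolume (the volume of a fundamental domain). -/
def packingDensity {k : ℕ} (Λ : Submodule ℤ (EuclideanSpace ℝ (Fin k))) : ℝ :=
  MeasureTheory.volume.real (Metric.ball (0 : EuclideanSpace ℝ (Fin k)) (minNorm Λ / 2)) /
    ZLattice.covolume Λ

/-- The image `g Λ` of `Λ` under an invertible linear map `g` of `ℝ^k`. -/
def latticeImage {k : ℕ}
    (g : (EuclideanSpace ℝ (Fin k) →L[ℝ] EuclideanSpace ℝ (Fin k))ˣ)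
    (Λ : Submodule ℤ (EuclideanSpace ℝ (Fin k))) : Submodule ℤ (EuclideanSpace ℝ (Fin k)) :=
  Λ.map (LinearMap.restrictScalars ℤ
    (g : EuclideanSpace ℝ (Fin k) →L[ℝ] EuclideanSpace ℝ (Fin k)).toLinearMap)

/-- A lattice `Λ` in `ℝ^k` is extreme if the packing density has a local maximum at `Λ` on the
space of lattices in `ℝ^k`. That space is the orbit of `Λ` under the general linear group, with
the quotient topology of that group, so this says that the function `g ↦ packingDensity (g Λ)`
has a local maximum at `g = 1`. -/
def IsExtremeLattice {k : ℕ} (Λ : Submodule ℤ (EuclideanSpace ℝ (Fin k))) : Prop :=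
  IsLattice Λ ∧
    IsLocalMax (fun g : (EuclideanSpace ℝ (Fin k) →L[ℝ] EuclideanSpace ℝ (Fin k))ˣ =>
      packingDensity (latticeImage g Λ)) 1

end

/-!
The vectors `f i` are only the obvious unit vectors of the lattice `Λ` that they generate. The key
point is that `± f i` are all of them (`maximalETF_unit_vectors`), so that with `|Λ| = 1` the set
of minimal vectors is known. The tight frame identity is then strong eutaxy with equal
coefficients `γ / 2`, and perfection is Gerzon's argument: the matrices `f i (f i)ᵀ` are linearly
independent, since their Gram matrix is `(1 - c²) I + c² J`, and there are as many of them as the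
dimension of the space of symmetric matrices (`maximalETF_span_vecMulVec`).

For the unit vectors, comparison of the frame identity at one and at two frame vectors gives
`c² = 1 / (k + 2)` and, since `k ≠ 3`, that `m = 1 / c` is an integer (`maximalETF_exists_sq`); a
determinant modulo `2` shows that `m` is odd (`maximalETF_odd`). Hence, for `x` in `Λ`, the
numbers `y i = m ⟨f i, x⟩` are integers of equal parity. If `‖x‖ = 1`, the frame identity gives
`∑ y²`, and the expansion of `x xᵀ` in the matrices `f i (f i)ᵀ` (`maximalETF_design`) gives `∑ y⁴`.
Together they say that `∑ y² (y² - 3) = 0`, which excludes even `y i`, not all of them being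
zero, and that `∑ (y² - 1) (m² - y²) = 0`, which for odd `y i`, bounded by `m`, forces
`|y i| ∈ {1, m}` for all `i`; the value `m` occurs by the second moment, and then `x = ± f i`.

Extremality is Voronoi's argument (`pow_le_det_sq`), made explicit by the design expansion. For
`g` near the identity and `μ = min ‖g (f i)‖²`, the form `‖g x‖² - μ ‖x‖²` is bounded on the unit
sphere by `D = ∑ i, (‖g (f i)‖² - μ)`, and its trace is `γ D`. The determinant of `gᵀ g` is therefore
at least `μ ^ k` as soon as `D` is small, and `μ` bounds the squared minimal norm of `g Λ`.
-/

/-! ### Parameters of a maximal equiangular tight frame -/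

section Frame

variable {n k : ℕ} {f : Fin n → EuclideanSpace ℝ (Fin k)} {γ c : ℝ}

theorem tightFrame_inner
    (hγ : ∀ x : EuclideanSpace ℝ (Fin k), ‖x‖ ^ 2 = γ * ∑ i, inner ℝ (f i) x ^ 2)
    (x y : EuclideanSpace ℝ (Fin k)) :
    inner ℝ x y = γ * ∑ i, inner ℝ (f i) x * inner ℝ (f i) y := by
  have h1 := hγ (x + y)
  have h2 := hγ (x - y)
  have h3 : inner ℝ x y = (‖x + y‖ ^ 2 - ‖x - y‖ ^ 2) / 4 := by
    rw [norm_add_sq_real, norm_sub_sq_real]; ring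
  rw [h3, h1, h2, ← mul_sub, ← Finset.sum_sub_distrib, mul_div_assoc, Finset.sum_div]
  congr 1
  refine Finset.sum_congr rfl fun i _ => ?_
  rw [inner_add_right, inner_sub_right]
  ring

/-- The trace of the frame identity. -/
theorem tightFrame_dim
    (hγ : ∀ x : EuclideanSpace ℝ (Fin k), ‖x‖ ^ 2 = γ * ∑ i, inner ℝ (f i) x ^ 2)
    (hf1 : ∀ i, ‖f i‖ = 1) : (k : ℝ) = γ * n := by
  let b := EuclideanSpace.basisFun (Fin k) ℝ
  have h1 : ∑ l, ‖b l‖ ^ 2 = (k : ℝ) := by simp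
  have h2 : ∀ i, ∑ l, inner ℝ (f i) (b l) ^ 2 = 1 := fun i => by
    rw [b.sum_sq_inner_left, hf1, one_pow]
  rw [← h1]
  simp_rw [hγ]
  rw [← Finset.mul_sum, Finset.sum_comm]
  simp [h2]

theorem equiangular_inner_sq (hf1 : ∀ i, ‖f i‖ = 1)
    (hc : ∀ i j, i ≠ j → |inner ℝ (f i) (f j)| = c) (i j : Fin n) :
    inner ℝ (f i) (f j) ^ 2 = (if i = j then 1 - c ^ 2 else 0) + c ^ 2 := by
  split_ifs with h
  · subst h
    rw [real_inner_self_eq_norm_sq, hf1]; ring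
  · rw [← sq_abs, hc i j h]; ring

/-- For a maximal equiangular tight frame, `1 / γ = (k + 1) / 2`, and comparing this with the
frame identity at a frame vector determines the angle. -/
theorem maximalETF_params (hk : 3 < k) (hn : 2 * n = k * (k + 1))
    (hγ : ∀ x : EuclideanSpace ℝ (Fin k), ‖x‖ ^ 2 = γ * ∑ i, inner ℝ (f i) x ^ 2)
    (hf1 : ∀ i, ‖f i‖ = 1) (hc : ∀ i j, i ≠ j → |inner ℝ (f i) (f j)| = c) :
    γ * (k + 1) = 2 ∧ c ^ 2 * (k + 2) = 1 := by
  have hk' : (3 : ℝ) < k := by exact_mod_cast hk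
  have hn' : 2 * (n : ℝ) = k * (k + 1) := by exact_mod_cast hn
  have hd := tightFrame_dim hγ hf1
  have hn0 : 0 < n := by
    rcases Nat.eq_zero_or_pos n with h | h
    · subst h
      have : 0 < k * (k + 1) := by positivity
      omega
    · exact h
  have h1 : γ * (k + 1) = 2 := by
    have : (k : ℝ) * (γ * (k + 1)) = k * 2 := by linear_combination (-γ) * hn' + (-2) * hd
    exact mul_left_cancel₀ (by linarith) this
  refine ⟨h1, ?_⟩
  have h2 := hγ (f ⟨0, hn0⟩)
  simp_rw [equiangular_inner_sq hf1 hc, hf1] at h2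
  rw [Finset.sum_add_distrib] at h2
  simp only [Finset.sum_ite_eq', Finset.mem_univ, if_true, Finset.sum_const, Finset.card_univ,
    Fintype.card_fin, nsmul_eq_mul, one_pow] at h2
  have h3 : ((k : ℝ) - 1) * (c ^ 2 * (k + 2)) = (k - 1) * 1 := by
    linear_combination (-(k + 1 : ℝ)) * h2 + (-(1 - c ^ 2 + n * c ^ 2)) * h1 + (-c ^ 2) * hn'
  exact mul_left_cancel₀ (by linarith) h3

/-- The Seidel matrix of an equiangular family of unit vectors. -/
theorem exists_seidel (hf1 : ∀ i, ‖f i‖ = 1)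
    (hc : ∀ i j, i ≠ j → |inner ℝ (f i) (f j)| = c) :
    ∃ S : Fin n → Fin n → ℤ, (∀ i, S i i = 0) ∧ (∀ i j, i ≠ j → S i j = 1 ∨ S i j = -1) ∧
      ∀ i j, inner ℝ (f i) (f j) = (if i = j then 1 else 0) + c * S i j := by
  refine ⟨fun i j => if i = j then 0 else if 0 ≤ inner ℝ (f i) (f j) then 1 else -1,
    fun i => by simp, fun i j h => ?_, fun i j => ?_⟩
  · simp only [h, if_false]
    split_ifs <;> simp
  · by_cases h : i = j
    · subst h
      simp [hf1]
    · have := hc i j h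
      simp only [h, if_false, zero_add]
      split_ifs with h0
      · rw [abs_of_nonneg h0] at this
        simp [this]
      · rw [abs_of_neg (not_le.1 h0)] at this
        simp [← this]

/-- `k + 2` is a perfect square: off the diagonal, the frame identity makes `(k - 3) / (2c)` an
integer, and `k ≠ 3`. -/
theorem maximalETF_exists_sq (hk : 3 < k) (hn : 2 * n = k * (k + 1))
    (hγ : ∀ x : EuclideanSpace ℝ (Fin k), ‖x‖ ^ 2 = γ * ∑ i, inner ℝ (f i) x ^ 2)
    (hf1 : ∀ i, ‖f i‖ = 1) (hc0 : 0 < c) (hc : ∀ i j, i ≠ j → |inner ℝ (f i) (f j)| = c) :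
    ∃ m : ℕ, m ^ 2 = k + 2 ∧ (m : ℝ) * c = 1 := by
  obtain ⟨hg, hck⟩ := maximalETF_params hk hn hγ hf1 hc
  obtain ⟨S, hS0, hS1, hS⟩ := exists_seidel hf1 hc
  have hn2 : 1 < n := by nlinarith
  let i : Fin n := ⟨0, by omega⟩
  let j : Fin n := ⟨1, hn2⟩
  have hij : i ≠ j := by simp [i, j]
  have hsymm : S j i = S i j := by
    have h := hS j i
    rw [real_inner_comm, hS i j, if_neg hij, if_neg hij.symm] at h
    have := mul_left_cancel₀ hc0.ne' (add_left_cancel h)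
    exact_mod_cast this.symm
  have h1 := tightFrame_inner hγ (f i) (f j)
  have h2 : ∀ l, inner ℝ (f l) (f i) * inner ℝ (f l) (f j) =
      (if l = i then c * (S i j : ℝ) else 0) + (if l = j then c * (S i j : ℝ) else 0) +
        c ^ 2 * ((S l i * S l j : ℤ) : ℝ) := fun l => by
    rw [hS l i, hS l j]
    by_cases hi : l = i
    · subst hi
      simp [hij, hS0]
    · by_cases hj : l = j
      · subst hj
        simp [hij.symm, hS0, hsymm]
      · simp [hi, hj]; ring
  simp_rw [h2] at h1
  rw [hS i j, if_neg hij, zero_add, Finset.sum_add_distrib, Finset.sum_add_distrib,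
    Finset.sum_ite_eq', Finset.sum_ite_eq', if_pos (Finset.mem_univ _),
    if_pos (Finset.mem_univ _), ← Finset.mul_sum, ← Int.cast_sum] at h1
  set N : ℤ := ∑ l, S l i * S l j with hN
  have hS2 : (S i j : ℝ) ^ 2 = 1 := by
    rcases hS1 i j hij with h | h <;> simp [h]
  have h3 : ((k : ℝ) - 3) * S i j = 2 * c * N := by
    have : c * (((k : ℝ) - 3) * S i j) = c * (2 * c * N) := by
      linear_combination (k + 1 : ℝ) * h1 + (c * S i j * 2 + c ^ 2 * N) * hg
    exact mul_left_cancel₀ hc0.ne' this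
  have h4 : ((k : ℝ) - 3) ^ 2 * (k + 2) = (2 * N) ^ 2 := by
    linear_combination (-((k : ℝ) - 3) ^ 2 * (k + 2)) * hS2 + (2 * N : ℝ) ^ 2 * hck +
      (k + 2 : ℝ) * ((k - 3) * S i j + 2 * c * N) * h3
  have h5 : ((k : ℤ) - 3) ^ 2 * (k + 2) = (2 * N) ^ 2 := by exact_mod_cast h4
  obtain ⟨M, hM⟩ := (Int.pow_dvd_pow_iff two_ne_zero).1 (Dvd.intro _ h5)
  have h6 : (k : ℤ) + 2 = M ^ 2 := by
    have h0 : ((k : ℤ) - 3) ^ 2 ≠ 0 := pow_ne_zero _ (by omega)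
    refine mul_left_cancel₀ h0 ?_
    rw [h5, hM]; ring
  refine ⟨M.natAbs, ?_, ?_⟩
  · zify
    rw [sq_abs, h6]
  · have h7 : ((M.natAbs : ℕ) : ℝ) ^ 2 = k + 2 := by
      rw [Nat.cast_natAbs, Int.cast_abs, sq_abs]
      exact_mod_cast h6.symm
    have h8 : ((M.natAbs : ℝ) * c) ^ 2 = 1 := by rw [mul_pow, h7, ← hck]; ring
    exact (pow_eq_one_iff_of_nonneg (by positivity) two_ne_zero).1 h8

/-- `1 / c` is odd: if it were even, the integer matrix `(1 / c) • G`, with `G` the Gram matrix of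
`k + 2` frame vectors, would be congruent to `J - I` modulo `2` and hence nonsingular, although
`k + 2` vectors of `ℝ^k` are linearly dependent. -/
theorem maximalETF_odd (hk : 3 < k) (hn : 2 * n = k * (k + 1)) (hf1 : ∀ i, ‖f i‖ = 1)
    (hc : ∀ i j, i ≠ j → |inner ℝ (f i) (f j)| = c) {m : ℕ} (hm : m ^ 2 = k + 2)
    (hmc : (m : ℝ) * c = 1) : Odd m := by
  by_contra hodd
  have hev : Even m := Nat.not_odd_iff_even.1 hodd
  obtain ⟨S, hS0, hS1, hS⟩ := exists_seidel hf1 hc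
  have hle : k + 2 ≤ n := by nlinarith
  let e : Fin (k + 2) → Fin n := Fin.castLE hle
  have he : ∀ a b, e a = e b ↔ a = b := fun a b => (Fin.castLE_injective hle).eq_iff
  let A : Matrix (Fin (k + 2)) (Fin (k + 2)) ℤ :=
    Matrix.of fun a b => (if a = b then (m : ℤ) else 0) + S (e a) (e b)
  have hA2 : A.map (Int.castRingHom (ZMod 2)) = Matrix.of fun a b => if a = b then 0 else 1 := by
    ext a b
    have hm0 : ((m : ℕ) : ZMod 2) = 0 := (ZMod.natCast_eq_zero_iff_even).2 hev
    by_cases h : a = b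
    · subst h
      simp [A, hS0, hm0]
    · have h' : e a ≠ e b := fun h0 => h ((he a b).1 h0)
      rcases hS1 _ _ h' with h1 | h1 <;> simp [A, h, h1]
  have hk0 : ((k : ℕ) : ZMod 2) = 0 := by
    rw [ZMod.natCast_eq_zero_iff_even]
    have : Even (k + 2) := hm ▸ hev.pow_of_ne_zero two_ne_zero
    simpa [Nat.even_add] using this
  have hB : (A.map (Int.castRingHom (ZMod 2))) * (A.map (Int.castRingHom (ZMod 2))) = 1 := by
    rw [hA2]
    ext a b
    have : ∀ l : Fin (k + 2), (if a = l then (0 : ZMod 2) else 1) * (if l = b then 0 else 1) =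
        1 - (if a = l then 1 else 0) - (if b = l then 1 else 0) +
          (if a = l then (if a = b then 1 else 0) else 0) := fun l => by
      by_cases h1 : a = l
      · subst h1
        by_cases h2 : a = b
        · rw [if_pos rfl, if_pos rfl, if_pos h2, if_pos h2.symm, if_pos rfl, if_pos h2]
          ring
        · rw [if_pos rfl, if_pos rfl, if_neg h2, if_neg (Ne.symm h2), if_pos rfl, if_neg h2]
          ring
      · by_cases h2 : l = b
        · subst h2; simp [h1]
        · simp [h1, h2, Ne.symm h2]
    simp_rw [Matrix.mul_apply, Matrix.of_apply, this]
    rw [Finset.sum_add_distrib, Finset.sum_sub_distrib, Finset.sum_sub_distrib]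
    have h4 : (2 : ZMod 2) = 0 := rfl
    simp only [Finset.sum_const, Finset.card_univ, Fintype.card_fin, nsmul_eq_mul, Nat.cast_add,
      hk0, Finset.sum_ite_eq, Finset.mem_univ, if_true, Matrix.one_apply]
    simp only [Nat.cast_ofNat, h4]
    linear_combination (-1) * h4
  have hdet : A.det ≠ 0 := fun h0 => by
    have h1 : (A.map (Int.castRingHom (ZMod 2))).det = 0 := by
      have := RingHom.map_det (Int.castRingHom (ZMod 2)) A
      rw [h0, map_zero] at this
      exact this.symm
    have h2 := congrArg Matrix.det hB
    rw [Matrix.det_mul, h1, Matrix.det_one] at h2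
    simp at h2
  have hdetR : (A.map (Int.castRingHom ℝ)).det ≠ 0 := by
    have := RingHom.map_det (Int.castRingHom ℝ) A
    rw [RingHom.mapMatrix_apply] at this
    rw [← this]
    simpa using hdet
  have hAR : ∀ a b, (A.map (Int.castRingHom ℝ)) a b = m * inner ℝ (f (e a)) (f (e b)) :=
    fun a b => by
      rw [hS, mul_add, ← mul_assoc, hmc]
      simp [A, he]
  have hli : LinearIndependent ℝ (fun a => f (e a)) := by
    rw [Fintype.linearIndependent_iff]
    intro w hw
    have : (A.map (Int.castRingHom ℝ)).mulVec w = 0 := by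
      ext a
      have h1 : inner ℝ (f (e a)) (∑ b, w b • f (e b)) = 0 := by rw [hw, inner_zero_right]
      simp_rw [inner_sum, inner_smul_right] at h1
      simp_rw [Matrix.mulVec, dotProduct, hAR, Pi.zero_apply]
      rw [← mul_zero (m : ℝ), ← h1, Finset.mul_sum]
      exact Finset.sum_congr rfl fun b _ => by ring
    exact fun a => congrFun (Matrix.eq_zero_of_mulVec_eq_zero hdetR this) a
  have := hli.fintype_card_le_finrank
  simp at this

end Frame

/-! ### Symmetric matrices and the design property -/

/-- The symmetric matrix with entries `w s(p, q)`; its range is the space of symmetric matrices. -/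
def symmMatrixOfSym2 (k : ℕ) : (Sym2 (Fin k) → ℝ) →ₗ[ℝ] Matrix (Fin k) (Fin k) ℝ where
  toFun w := Matrix.of fun p q => w s(p, q)
  map_add' _ _ := rfl
  map_smul' _ _ := rfl

theorem mem_range_symmMatrixOfSym2 {k : ℕ} {A : Matrix (Fin k) (Fin k) ℝ} :
    A ∈ LinearMap.range (symmMatrixOfSym2 k) ↔ A.IsSymm := by
  constructor
  · rintro ⟨w, rfl⟩
    ext p q
    exact congrArg w Sym2.eq_swap
  · intro hA
    refine ⟨Sym2.lift ⟨fun p q => A p q, fun p q => (hA.apply p q).symm⟩, ?_⟩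
    ext p q
    rfl

theorem two_mul_finrank_symmMatrix_le (k : ℕ) :
    2 * Module.finrank ℝ (LinearMap.range (symmMatrixOfSym2 k)) ≤ k * (k + 1) := by
  have h1 := LinearMap.finrank_range_le (symmMatrixOfSym2 k)
  rw [Module.finrank_fintype_fun_eq_card, Sym2.card, Fintype.card_fin, Nat.choose_two_right,
    Nat.add_sub_cancel] at h1
  have := Nat.div_mul_le_self ((k + 1) * k) 2
  rw [mul_comm k]
  omega

/-- Evaluation `A ↦ yᵀ A y` of the quadratic form of a matrix at a fixed vector. -/
def quadEval {k : ℕ} (y : EuclideanSpace ℝ (Fin k)) : Matrix (Fin k) (Fin k) ℝ →ₗ[ℝ] ℝ where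
  toFun A := y.ofLp ⬝ᵥ A.mulVec y.ofLp
  map_add' A B := by rw [Matrix.add_mulVec, dotProduct_add]
  map_smul' a A := by rw [Matrix.smul_mulVec, dotProduct_smul]; rfl

theorem quadEval_vecMulVec {k : ℕ} (x y : EuclideanSpace ℝ (Fin k)) :
    quadEval y (Matrix.vecMulVec x.ofLp x.ofLp) = inner ℝ x y ^ 2 := by
  have h : inner ℝ x y = y.ofLp ⬝ᵥ x.ofLp := by
    rw [EuclideanSpace.inner_eq_star_dotProduct, star_trivial]
  change y.ofLp ⬝ᵥ (Matrix.vecMulVec x.ofLp x.ofLp).mulVec y.ofLp = _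
  rw [Matrix.vecMulVec_mulVec, dotProduct_smul, h, dotProduct_comm x.ofLp y.ofLp]
  simp [sq]

section Design

variable {n k : ℕ} {f : Fin n → EuclideanSpace ℝ (Fin k)} {γ c : ℝ}

theorem sum_mul_equiangular_inner_sq (hf1 : ∀ i, ‖f i‖ = 1)
    (hc : ∀ i j, i ≠ j → |inner ℝ (f i) (f j)| = c) (w : Fin n → ℝ) (i : Fin n) :
    ∑ j, w j * inner ℝ (f j) (f i) ^ 2 = (1 - c ^ 2) * w i + c ^ 2 * ∑ j, w j := by
  simp_rw [equiangular_inner_sq hf1 hc, mul_add, Finset.sum_add_distrib, mul_ite, mul_zero,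
    Finset.sum_ite_eq', Finset.mem_univ, if_true, ← Finset.sum_mul]
  ring

/-- Gerzon: the projections onto equiangular lines are linearly independent. -/
theorem equiangular_linearIndependent (hf1 : ∀ i, ‖f i‖ = 1) (hc0 : 0 < c) (hc1 : c < 1)
    (hc : ∀ i j, i ≠ j → |inner ℝ (f i) (f j)| = c) :
    LinearIndependent ℝ (fun j => Matrix.vecMulVec (f j).ofLp (f j).ofLp) := by
  rw [Fintype.linearIndependent_iff]
  intro w hw
  have h1 : ∀ i, (1 - c ^ 2) * w i + c ^ 2 * ∑ j, w j = 0 := fun i => by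
    have := congrArg (quadEval (f i)) hw
    simp_rw [map_sum, map_smul, map_zero, quadEval_vecMulVec, smul_eq_mul] at this
    rwa [sum_mul_equiangular_inner_sq hf1 hc] at this
  have hcc : 0 < 1 - c ^ 2 := by nlinarith
  have h2 : ((1 - c ^ 2) + n * c ^ 2) * ∑ j, w j = 0 := by
    have : ∑ i, ((1 - c ^ 2) * w i + c ^ 2 * ∑ j, w j) = 0 :=
      Finset.sum_eq_zero fun i _ => h1 i
    rw [Finset.sum_add_distrib, ← Finset.mul_sum, Finset.sum_const, Finset.card_univ,
      Fintype.card_fin, nsmul_eq_mul] at this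
    linear_combination this
  have h3 : ∑ j, w j = 0 := by
    refine (mul_eq_zero.1 h2).resolve_left (ne_of_gt ?_)
    positivity
  intro i
  have := h1 i
  rw [h3, mul_zero, add_zero] at this
  exact (mul_eq_zero.1 this).resolve_left hcc.ne'

theorem maximalETF_span_vecMulVec (hn : 2 * n = k * (k + 1)) (hf1 : ∀ i, ‖f i‖ = 1) (hc0 : 0 < c)
    (hc1 : c < 1) (hc : ∀ i j, i ≠ j → |inner ℝ (f i) (f j)| = c) :
    Submodule.span ℝ (Set.range fun j => Matrix.vecMulVec (f j).ofLp (f j).ofLp) =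
      LinearMap.range (symmMatrixOfSym2 k) := by
  apply Submodule.eq_of_le_of_finrank_le
  · rw [Submodule.span_le]
    rintro _ ⟨j, rfl⟩
    rw [SetLike.mem_coe, mem_range_symmMatrixOfSym2]
    exact Matrix.transpose_vecMulVec _ _
  · rw [finrank_span_eq_card (equiangular_linearIndependent hf1 hc0 hc1 hc), Fintype.card_fin]
    have := two_mul_finrank_symmMatrix_le k
    omega

/-- The design property: expansion of the square of a linear form `⟨x, ·⟩` in the squares of the
forms `⟨f j, ·⟩`, with explicit coefficients. -/
theorem maximalETF_design (hn : 2 * n = k * (k + 1)) (hf1 : ∀ i, ‖f i‖ = 1) (hc0 : 0 < c)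
    (hc1 : c < 1) (hc : ∀ i j, i ≠ j → |inner ℝ (f i) (f j)| = c)
    (x y : EuclideanSpace ℝ (Fin k)) :
    (1 - c ^ 2) * inner ℝ x y ^ 2 =
      ∑ j, (inner ℝ (f j) x ^ 2 - c ^ 2 * ‖x‖ ^ 2) * inner ℝ (f j) y ^ 2 := by
  have hx : Matrix.vecMulVec x.ofLp x.ofLp ∈ LinearMap.range (symmMatrixOfSym2 k) :=
    mem_range_symmMatrixOfSym2.2 (Matrix.transpose_vecMulVec _ _)
  rw [← maximalETF_span_vecMulVec hn hf1 hc0 hc1 hc,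
    Submodule.mem_span_range_iff_exists_fun] at hx
  obtain ⟨w, hw⟩ := hx
  have h1 : ∀ z, inner ℝ x z ^ 2 = ∑ j, w j * inner ℝ (f j) z ^ 2 := fun z => by
    have := congrArg (quadEval z) hw
    simp_rw [map_sum, map_smul, quadEval_vecMulVec, smul_eq_mul] at this
    exact this.symm
  have h2 : ‖x‖ ^ 2 = ∑ j, w j := by
    let b := EuclideanSpace.basisFun (Fin k) ℝ
    rw [← b.sum_sq_inner_left]
    simp_rw [h1]
    rw [Finset.sum_comm]
    simp_rw [← Finset.mul_sum, b.sum_sq_inner_left, hf1, one_pow, mul_one]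
  have h3 : ∀ j, inner ℝ (f j) x ^ 2 - c ^ 2 * ‖x‖ ^ 2 = (1 - c ^ 2) * w j := fun j => by
    rw [real_inner_comm, h1, sum_mul_equiangular_inner_sq hf1 hc, h2]
    ring
  rw [h1, Finset.mul_sum]
  exact Finset.sum_congr rfl fun j _ => by rw [h3, mul_assoc]

end Design

/-! ### The minimal vectors -/

section MinVectors

variable {n k : ℕ} {f : Fin n → EuclideanSpace ℝ (Fin k)} {γ c : ℝ}

/-- Scaled by the odd number `m = 1 / c`, the inner products of a vector of the integral span with
the frame vectors are integers of the same parity. -/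
theorem integralSpan_inner_parity (hf1 : ∀ i, ‖f i‖ = 1)
    (hc : ∀ i j, i ≠ j → |inner ℝ (f i) (f j)| = c) {m : ℕ} (hmc : (m : ℝ) * c = 1)
    (hodd : Odd m) {x : EuclideanSpace ℝ (Fin k)} (hx : x ∈ integralSpan f) :
    ∃ y : Fin n → ℤ, (∀ i, (y i : ℝ) = m * inner ℝ (f i) x) ∧
      ((∀ i, Even (y i)) ∨ ∀ i, Odd (y i)) := by
  obtain ⟨S, hS0, hS1, hS⟩ := exists_seidel hf1 hc
  rw [integralSpan, Submodule.mem_span_range_iff_exists_fun] at hx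
  obtain ⟨a, rfl⟩ := hx
  have hm1 : ((m : ℕ) : ZMod 2) = 1 := (ZMod.natCast_eq_one_iff_odd).2 hodd
  have hpar : ∀ i, ((m * a i + ∑ j, a j * S i j : ℤ) : ZMod 2) = ((∑ j, a j : ℤ) : ZMod 2) := by
    intro i
    have h1 : ∀ j, ((S i j : ℤ) : ZMod 2) = if i = j then 0 else 1 := fun j => by
      by_cases h : i = j
      · subst h; simp [hS0]
      · rcases hS1 i j h with h1 | h1 <;> simp [h, h1]
    push_cast
    simp_rw [h1, hm1]
    rw [← Finset.add_sum_erase _ _ (Finset.mem_univ i),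
      ← Finset.add_sum_erase (Finset.univ) (fun j => ((a j : ℤ) : ZMod 2)) (Finset.mem_univ i)]
    simp only [if_true, mul_zero, zero_add, one_mul]
    congr 1
    refine Finset.sum_congr rfl fun j hj => ?_
    rw [if_neg (Finset.ne_of_mem_erase hj).symm, mul_one]
  refine ⟨fun i => m * a i + ∑ j, a j * S i j, fun i => ?_, ?_⟩
  · simp_rw [inner_sum, inner_smul_right_eq_smul, hS]
    push_cast
    simp_rw [zsmul_eq_mul, mul_add, Finset.sum_add_distrib, mul_ite, mul_one, mul_zero,
      Finset.sum_ite_eq, Finset.mem_univ, if_true, mul_add, Finset.mul_sum]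
    congr 1
    refine Finset.sum_congr rfl fun j _ => ?_
    linear_combination (-(a j * S i j : ℝ)) * hmc
  · rcases Int.even_or_odd (∑ j, a j) with h | h
    · left
      intro i
      rw [← ZMod.intCast_eq_zero_iff_even, hpar, ZMod.intCast_eq_zero_iff_even]
      exact h
    · right
      intro i
      rw [← ZMod.intCast_eq_one_iff_odd, hpar, ZMod.intCast_eq_one_iff_odd]
      exact h

/-- The unit vectors of the integral span are the frame vectors and their negatives. The second
and fourth moments of the integers `m * ⟨f i, x⟩` are known; they are incompatible with all of
these being even, and for odd ones they force one of them to be `± m`. -/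
theorem maximalETF_unit_vectors (hk : 3 < k) (hn : 2 * n = k * (k + 1))
    (hγ : ∀ x : EuclideanSpace ℝ (Fin k), ‖x‖ ^ 2 = γ * ∑ i, inner ℝ (f i) x ^ 2)
    (hf1 : ∀ i, ‖f i‖ = 1) (hc0 : 0 < c) (hc1 : c < 1)
    (hc : ∀ i j, i ≠ j → |inner ℝ (f i) (f j)| = c)
    {x : EuclideanSpace ℝ (Fin k)} (hx : x ∈ integralSpan f) (hx1 : ‖x‖ = 1) :
    ∃ i, x = f i ∨ x = -f i := by
  obtain ⟨hg, hck⟩ := maximalETF_params hk hn hγ hf1 hc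
  obtain ⟨m, hm, hmc⟩ := maximalETF_exists_sq hk hn hγ hf1 hc0 hc
  have hodd := maximalETF_odd hk hn hf1 hc hm hmc
  obtain ⟨y, hy, hpar⟩ := integralSpan_inner_parity hf1 hc hmc hodd hx
  have hmk : (m : ℝ) ^ 2 = k + 2 := by exact_mod_cast hm
  have hkr : (3 : ℝ) < k := by exact_mod_cast hk
  have hmc2 : (m : ℝ) ^ 2 * c ^ 2 = 1 := by rw [← mul_pow, hmc, one_pow]
  -- Second moment: the frame identity.
  have h2 : 2 * ∑ i, (y i : ℝ) ^ 2 = m ^ 2 * (m ^ 2 - 1) := by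
    have h := hγ x
    rw [hx1] at h
    have h' : ∑ i, (y i : ℝ) ^ 2 = (m : ℝ) ^ 2 * ∑ i, inner ℝ (f i) x ^ 2 := by
      simp_rw [hy, mul_pow, Finset.mul_sum]
    rw [h']
    have hg' : γ * (m ^ 2 - 1) = 2 := by rw [hmk]; linear_combination hg
    linear_combination (-(∑ i, inner ℝ (f i) x ^ 2) * (m : ℝ) ^ 2) * hg' -
      (m : ℝ) ^ 2 * (m ^ 2 - 1) * h
  -- Fourth moment: the design property.
  have h4 : ∑ i, ((y i : ℝ) ^ 2 - 1) * (y i : ℝ) ^ 2 = (m : ℝ) ^ 2 * (m ^ 2 - 1) := by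
    have h := maximalETF_design hn hf1 hc0 hc1 hc x x
    rw [real_inner_self_eq_norm_sq, hx1] at h
    have h' : ∑ i, ((y i : ℝ) ^ 2 - 1) * (y i : ℝ) ^ 2 =
        (m : ℝ) ^ 4 * ∑ j, (inner ℝ (f j) x ^ 2 - c ^ 2 * 1 ^ 2) * inner ℝ (f j) x ^ 2 := by
      rw [Finset.mul_sum]
      refine Finset.sum_congr rfl fun i _ => ?_
      rw [hy]
      linear_combination ((m : ℝ) ^ 2 * inner ℝ (f i) x ^ 2) * hmc2
    rw [h', ← h]
    linear_combination (-(m : ℝ) ^ 2) * hmc2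
  rcases hpar with hev | hod
  · exfalso
    have h0 : ∑ i, (y i : ℝ) ^ 2 * ((y i : ℝ) ^ 2 - 3) = 0 := by
      have : ∀ i, (y i : ℝ) ^ 2 * ((y i : ℝ) ^ 2 - 3) =
          ((y i : ℝ) ^ 2 - 1) * (y i : ℝ) ^ 2 - 2 * (y i : ℝ) ^ 2 := fun i => by ring
      simp_rw [this]
      rw [Finset.sum_sub_distrib, ← Finset.mul_sum, h4, h2, sub_self]
    have hlow : ∀ i, y i ≠ 0 → (4 : ℝ) ≤ (y i : ℝ) ^ 2 := fun i hi => by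
      obtain ⟨t, ht⟩ := hev i
      have ht0 : t ≠ 0 := fun h => hi (by rw [ht, h, add_zero])
      have : 1 ≤ t ^ 2 := Int.one_le_abs (pow_ne_zero 2 ht0) |>.trans_eq (abs_of_nonneg (sq_nonneg t))
      have h4 : (4 : ℤ) ≤ (y i) ^ 2 := by rw [ht]; nlinarith
      exact_mod_cast h4
    have hnn : ∀ i ∈ Finset.univ, 0 ≤ (y i : ℝ) ^ 2 * ((y i : ℝ) ^ 2 - 3) := fun i _ => by
      by_cases hi : y i = 0
      · simp [hi]
      · have := hlow i hi
        exact mul_nonneg (sq_nonneg _) (by linarith)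
    have hz : ∀ i, y i = 0 := fun i => by
      by_contra hi
      have h := (Finset.sum_eq_zero_iff_of_nonneg hnn).1 h0 i (Finset.mem_univ i)
      have := hlow i hi
      nlinarith
    simp [hz] at h2
    rcases h2 with h2 | h2
    · rw [h2] at hodd
      exact absurd hodd (by decide)
    · rw [hmk] at h2
      linarith
  · have hub : ∀ i, (y i : ℝ) ^ 2 ≤ m ^ 2 := fun i => by
      rw [hy, mul_pow]
      have h1 : inner ℝ (f i) x ^ 2 ≤ 1 := by
        rw [← sq_abs]
        have := abs_real_inner_le_norm (f i) x
        rw [hf1, hx1, one_mul] at this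
        exact pow_le_one₀ (abs_nonneg _) this
      exact mul_le_of_le_one_right (sq_nonneg _) h1
    have hlb : ∀ i, 1 ≤ (y i : ℝ) ^ 2 := fun i => by
      have h0 : y i ≠ 0 := fun h => by simpa [h] using hod i
      have : 1 ≤ (y i) ^ 2 :=
        Int.one_le_abs (pow_ne_zero 2 h0) |>.trans_eq (abs_of_nonneg (sq_nonneg _))
      exact_mod_cast this
    have hcard : ∑ _i : Fin n, (1 : ℝ) = n := by simp
    have hn' : 2 * (n : ℝ) = (m ^ 2 - 2) * (m ^ 2 - 1) := by
      rw [hmk]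
      have : 2 * (n : ℝ) = k * (k + 1) := by exact_mod_cast hn
      linear_combination this
    have hs1 : ∑ i, ((y i : ℝ) ^ 2 - 1) = (m : ℝ) ^ 2 - 1 := by
      rw [Finset.sum_sub_distrib, hcard]
      linear_combination h2 / 2 - hn' / 2
    have h0 : ∑ i, ((y i : ℝ) ^ 2 - 1) * (m ^ 2 - (y i : ℝ) ^ 2) = 0 := by
      simp_rw [mul_sub]
      rw [Finset.sum_sub_distrib, h4, ← Finset.sum_mul, hs1]
      ring
    have hz := (Finset.sum_eq_zero_iff_of_nonneg (fun i _ =>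
      mul_nonneg (sub_nonneg.2 (hlb i)) (sub_nonneg.2 (hub i)))).1 h0
    have hex : ∃ i, (y i : ℝ) ^ 2 = m ^ 2 := by
      by_contra! hne
      have : ∑ i, ((y i : ℝ) ^ 2 - 1) = 0 := Finset.sum_eq_zero fun i hi =>
        (mul_eq_zero.1 (hz i hi)).resolve_right fun h => hne i (sub_eq_zero.1 h).symm
      rw [hs1, hmk] at this
      linarith
    obtain ⟨i, hi⟩ := hex
    have hi1 : inner ℝ (f i) x ^ 2 = 1 := by
      rw [hy, mul_pow] at hi
      have : (m : ℝ) ^ 2 ≠ 0 := by rw [hmk]; positivity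
      exact mul_left_cancel₀ this (by rw [hi, mul_one])
    refine ⟨i, ?_⟩
    rcases mul_self_eq_one_iff.1 ((sq _).symm.trans hi1) with h | h
    · left
      exact ((inner_eq_one_iff_of_norm_eq_one (hf1 i) hx1).1 h).symm
    · right
      have := (inner_eq_one_iff_of_norm_eq_one (𝕜 := ℝ) (x := -f i) (by rw [norm_neg, hf1 i]) hx1).1
        (by rw [inner_neg_left, h, neg_neg])
      exact this.symm

end MinVectors

/-! ### The determinant inequality -/

theorem sub_two_mul_sq_le_log_one_add {e : ℝ} (he : -(1 / 2) ≤ e) :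
    e - 2 * e ^ 2 ≤ Real.log (1 + e) := by
  have h1 : 0 < 1 + e := by linarith
  refine le_trans ?_ (Real.one_sub_inv_le_log_of_pos h1)
  rw [← sub_nonneg]
  have : 1 - (1 + e)⁻¹ - (e - 2 * e ^ 2) = e ^ 2 * (1 + 2 * e) / (1 + e) := by
    field_simp
    ring
  rw [this]
  exact div_nonneg (mul_nonneg (sq_nonneg _) (by linarith)) h1.le

/-- A product of numbers close to `1` is at least `1` if the sum of the deviations dominates
their squares. -/
theorem one_le_prod_one_add {k : ℕ} {e : Fin k → ℝ} {t γ : ℝ} (ht : t ≤ 1 / 2)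
    (htk : 2 * k * t ≤ γ) (he : ∀ i, |e i| ≤ t) (hsum : ∑ i, e i = γ * t) (ht0 : 0 ≤ t) :
    1 ≤ ∏ i, (1 + e i) := by
  have hlow : ∀ i, -(1 / 2) ≤ e i := fun i => by linarith [neg_le_of_abs_le (he i)]
  have hpos : ∀ i, 0 < 1 + e i := fun i => by linarith [hlow i]
  have hprod : 0 < ∏ i, (1 + e i) := Finset.prod_pos fun i _ => hpos i
  rw [← Real.log_nonneg_iff hprod, Real.log_prod (fun i _ => (hpos i).ne')]
  have h1 : ∑ i, (e i - 2 * t ^ 2) ≤ ∑ i, Real.log (1 + e i) :=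
    Finset.sum_le_sum fun i _ => by
      have h := sub_two_mul_sq_le_log_one_add (hlow i)
      have h2 : e i ^ 2 ≤ t ^ 2 := by rw [← sq_abs]; exact pow_le_pow_left₀ (abs_nonneg _) (he i) 2
      linarith
  refine le_trans ?_ h1
  rw [Finset.sum_sub_distrib, hsum, Finset.sum_const, Finset.card_univ, Fintype.card_fin,
    nsmul_eq_mul]
  nlinarith

section Det

variable {n k : ℕ} {f : Fin n → EuclideanSpace ℝ (Fin k)} {γ c : ℝ}

/-- The design expansion, transported by a linear map `g`. -/
theorem maximalETF_design_map (hn : 2 * n = k * (k + 1)) (hf1 : ∀ i, ‖f i‖ = 1) (hc0 : 0 < c)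
    (hc1 : c < 1) (hc : ∀ i j, i ≠ j → |inner ℝ (f i) (f j)| = c)
    (g : EuclideanSpace ℝ (Fin k) →L[ℝ] EuclideanSpace ℝ (Fin k)) (x : EuclideanSpace ℝ (Fin k)) :
    (1 - c ^ 2) * ‖g x‖ ^ 2 =
      ∑ j, (inner ℝ (f j) x ^ 2 - c ^ 2 * ‖x‖ ^ 2) * ‖g (f j)‖ ^ 2 := by
  let b := EuclideanSpace.basisFun (Fin k) ℝ
  have h1 : ∀ z, ‖g z‖ ^ 2 = ∑ l, inner ℝ z (g.adjoint (b l)) ^ 2 := fun z => by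
    simp_rw [ContinuousLinearMap.adjoint_inner_right, b.sum_sq_inner_left]
  simp_rw [h1, Finset.mul_sum, maximalETF_design hn hf1 hc0 hc1 hc]
  rw [Finset.sum_comm]

/-- The frame identity, transported by a linear map `g`: the trace of `gᵀ g`. -/
theorem tightFrame_trace
    (hγ : ∀ x : EuclideanSpace ℝ (Fin k), ‖x‖ ^ 2 = γ * ∑ i, inner ℝ (f i) x ^ 2)
    (g : EuclideanSpace ℝ (Fin k) →L[ℝ] EuclideanSpace ℝ (Fin k))
    (u : OrthonormalBasis (Fin k) ℝ (EuclideanSpace ℝ (Fin k))) :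
    ∑ i, ‖g (u i)‖ ^ 2 = γ * ∑ j, ‖g (f j)‖ ^ 2 := by
  let b := EuclideanSpace.basisFun (Fin k) ℝ
  have h1 : ∀ z, ‖g z‖ ^ 2 = ∑ l, inner ℝ z (g.adjoint (b l)) ^ 2 := fun z => by
    simp_rw [ContinuousLinearMap.adjoint_inner_right, b.sum_sq_inner_left]
  simp_rw [h1]
  rw [Finset.sum_comm, Finset.sum_comm (γ := Fin n), Finset.mul_sum]
  exact Finset.sum_congr rfl fun l _ => by rw [u.sum_sq_inner_right, hγ]

/-- Voronoi's argument: put `μ = min ‖g (f i)‖²`. By the design property the quadratic form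
`‖g x‖² - μ ‖x‖²` is bounded by `D = ∑ i, (‖g (f i)‖² - μ)`, while its trace is `γ * D`. When `D`
is small, the trace dominates the second-order terms of the determinant of `gᵀ g`. -/
theorem pow_le_det_sq (hk : 3 < k) (hn : 2 * n = k * (k + 1))
    (hγ : ∀ x : EuclideanSpace ℝ (Fin k), ‖x‖ ^ 2 = γ * ∑ i, inner ℝ (f i) x ^ 2)
    (hf1 : ∀ i, ‖f i‖ = 1) (hc0 : 0 < c) (hc1 : c < 1)
    (hc : ∀ i j, i ≠ j → |inner ℝ (f i) (f j)| = c)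
    (g : EuclideanSpace ℝ (Fin k) →L[ℝ] EuclideanSpace ℝ (Fin k)) {μ : ℝ} (hμ : 0 < μ)
    (hg : ∀ i, μ ≤ ‖g (f i)‖ ^ 2)
    (hsmall : 2 * k * ∑ i, (‖g (f i)‖ ^ 2 - μ) ≤ γ * μ) :
    μ ^ k ≤ LinearMap.det (g : EuclideanSpace ℝ (Fin k) →ₗ[ℝ] EuclideanSpace ℝ (Fin k)) ^ 2 := by
  obtain ⟨hgk, hck⟩ := maximalETF_params hk hn hγ hf1 hc
  have hkr : (3 : ℝ) < k := by exact_mod_cast hk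
  have hcc : 0 < 1 - c ^ 2 := by nlinarith
  have hc2 : c ^ 2 ≤ 1 - c ^ 2 := by nlinarith
  have hn' : 2 * (n : ℝ) = k * (k + 1) := by exact_mod_cast hn
  have hdim := tightFrame_dim hγ hf1
  set D := ∑ i, (‖g (f i)‖ ^ 2 - μ) with hD
  have hD0 : 0 ≤ D := Finset.sum_nonneg fun i _ => sub_nonneg.2 (hg i)
  -- The constant form `μ ‖x‖²` satisfies the design expansion as well.
  have hone : ∀ x : EuclideanSpace ℝ (Fin k), (1 - c ^ 2) * ‖x‖ ^ 2 =
      ∑ j, (inner ℝ (f j) x ^ 2 - c ^ 2 * ‖x‖ ^ 2) := fun x => by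
    have := maximalETF_design_map hn hf1 hc0 hc1 hc (ContinuousLinearMap.id ℝ _) x
    simpa [hf1] using this
  have hform : ∀ x : EuclideanSpace ℝ (Fin k), ‖x‖ = 1 → |‖g x‖ ^ 2 - μ| ≤ D := fun x hx => by
    have h1 : (1 - c ^ 2) * (‖g x‖ ^ 2 - μ) =
        ∑ j, (inner ℝ (f j) x ^ 2 - c ^ 2) * (‖g (f j)‖ ^ 2 - μ) := by
      have h2 := maximalETF_design_map hn hf1 hc0 hc1 hc g x
      have h3 := hone x
      simp only [hx, one_pow, mul_one] at h2 h3
      simp_rw [mul_sub _ _ μ]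
      rw [Finset.sum_sub_distrib, ← Finset.sum_mul, ← h2, ← h3]
    have h2 : ∀ j, |inner ℝ (f j) x ^ 2 - c ^ 2| ≤ 1 - c ^ 2 := fun j => by
      have h3 : inner ℝ (f j) x ^ 2 ≤ 1 := by
        rw [← sq_abs]
        have := abs_real_inner_le_norm (f j) x
        rw [hf1, hx, one_mul] at this
        exact pow_le_one₀ (abs_nonneg _) this
      rw [abs_le]
      constructor <;> nlinarith [sq_nonneg (inner ℝ (f j) x)]
    have h4 : (1 - c ^ 2) * |‖g x‖ ^ 2 - μ| ≤ (1 - c ^ 2) * D := by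
      rw [← abs_of_pos hcc, ← abs_mul, abs_of_pos hcc, h1, hD, Finset.mul_sum]
      refine (Finset.abs_sum_le_sum_abs _ _).trans (Finset.sum_le_sum fun j _ => ?_)
      rw [abs_mul, abs_of_nonneg (sub_nonneg.2 (hg j))]
      exact mul_le_mul_of_nonneg_right (h2 j) (sub_nonneg.2 (hg j))
    exact le_of_mul_le_mul_left h4 hcc
  -- An orthonormal eigenbasis of `gᵀ g`.
  let g' : EuclideanSpace ℝ (Fin k) →ₗ[ℝ] EuclideanSpace ℝ (Fin k) := g
  have hT : (g'.adjoint ∘ₗ g').IsSymmetric := g'.isSymmetric_adjoint_mul_self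
  have hfr : Module.finrank ℝ (EuclideanSpace ℝ (Fin k)) = k := by simp
  let u := hT.eigenvectorBasis hfr
  have hev : ∀ i, hT.eigenvalues hfr i = ‖g (u i)‖ ^ 2 := fun i => by
    have h1 := hT.apply_eigenvectorBasis hfr i
    have h2 : inner ℝ (u i) ((g'.adjoint ∘ₗ g') (u i)) = ‖g (u i)‖ ^ 2 := by
      rw [LinearMap.comp_apply, LinearMap.adjoint_inner_right, real_inner_self_eq_norm_sq]
      rfl
    rw [← h2, h1, inner_smul_right, real_inner_self_eq_norm_sq, u.norm_eq_one]
    simp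
  have hdet : LinearMap.det g' ^ 2 = ∏ i, ‖g (u i)‖ ^ 2 := by
    have h1 := LinearMap.normDet_sq g'
    rw [LinearMap.normDet_eq_abs_det, sq_abs, hT.det_eq_prod_eigenvalues hfr] at h1
    simp only [hev] at h1
    exact_mod_cast h1
  have htr : ∑ i, (‖g (u i)‖ ^ 2 - μ) = γ * D := by
    rw [Finset.sum_sub_distrib, tightFrame_trace hγ g u, hD, Finset.sum_sub_distrib, mul_sub]
    simp only [Finset.sum_const, Finset.card_univ, Fintype.card_fin, nsmul_eq_mul]
    linear_combination (-μ) * hdim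
  have hDt : 2 * k * (D / μ) ≤ γ := by
    rw [← mul_div_assoc, div_le_iff₀ hμ]
    exact hsmall
  have hγ1 : γ ≤ 1 := by nlinarith
  have hDhalf : D / μ ≤ 1 / 2 := by
    have : 0 ≤ D / μ := by positivity
    nlinarith
  have hp := one_le_prod_one_add (e := fun i => (‖g (u i)‖ ^ 2 - μ) / μ) (t := D / μ) (γ := γ)
    hDhalf hDt (fun i => by
      rw [abs_div, abs_of_pos hμ]
      exact div_le_div_of_nonneg_right (hform _ (u.norm_eq_one i)) hμ.le)
    (by rw [← Finset.sum_div, htr, mul_div_assoc]) (by positivity)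
  have hp2 : ∏ i, (1 + (‖g (u i)‖ ^ 2 - μ) / μ) = (∏ i, ‖g (u i)‖ ^ 2) / μ ^ k := by
    have : ∀ i, 1 + (‖g (u i)‖ ^ 2 - μ) / μ = ‖g (u i)‖ ^ 2 / μ := fun i => by
      field_simp
      ring
    simp_rw [this]
    rw [Finset.prod_div_distrib]
    simp
  rw [hp2, le_div_iff₀ (by positivity), one_mul] at hp
  rw [show LinearMap.det (g : EuclideanSpace ℝ (Fin k) →ₗ[ℝ] EuclideanSpace ℝ (Fin k)) =
    LinearMap.det g' from rfl, hdet]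
  exact hp

end Det

/-! ### Lattices -/

open MeasureTheory in
theorem covolume_latticeImage {k : ℕ} {Λ : Submodule ℤ (EuclideanSpace ℝ (Fin k))}
    (hΛ : IsLattice Λ) (g : (EuclideanSpace ℝ (Fin k) →L[ℝ] EuclideanSpace ℝ (Fin k))ˣ) :
    ZLattice.covolume (latticeImage g Λ) =
      |LinearMap.det ((g : EuclideanSpace ℝ (Fin k) →L[ℝ] EuclideanSpace ℝ (Fin k)) :
        EuclideanSpace ℝ (Fin k) →ₗ[ℝ] EuclideanSpace ℝ (Fin k))| * ZLattice.covolume Λ := by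
  have := hΛ.1
  have : IsZLattice ℝ Λ := ⟨hΛ.2⟩
  let e : EuclideanSpace ℝ (Fin k) ≃L[ℝ] EuclideanSpace ℝ (Fin k) := ContinuousLinearEquiv.ofUnit g
  have hmap : latticeImage g Λ = ZLattice.comap ℝ Λ e.symm.toLinearMap := by
    ext x
    constructor
    · rintro ⟨y, hy, rfl⟩
      change e.symm (e y) ∈ Λ
      rwa [e.symm_apply_apply]
    · intro hx
      exact ⟨e.symm x, hx, e.apply_symm_apply x⟩
  let b := Module.Free.chooseBasis ℤ Λ
  rw [hmap, ZLattice.covolume_eq_measure_fundamentalDomain Λ volume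
      (ZLattice.isAddFundamentalDomain b volume),
    ZLattice.covolume_eq_measure_fundamentalDomain _ volume
      (ZLattice.isAddFundamentalDomain (b.ofZLatticeComap ℝ Λ e.symm.toLinearEquiv) volume)]
  have himg : ZSpan.fundamentalDomain ((b.ofZLatticeComap ℝ Λ e.symm.toLinearEquiv).ofZLatticeBasis ℝ
      (ZLattice.comap ℝ Λ e.symm.toLinearMap)) =
      (g : EuclideanSpace ℝ (Fin k) →L[ℝ] EuclideanSpace ℝ (Fin k)) ''
        ZSpan.fundamentalDomain (b.ofZLatticeBasis ℝ Λ) := by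
    have := ZSpan.map_fundamentalDomain (b.ofZLatticeBasis ℝ Λ) e.toLinearEquiv
    rw [Module.Basis.ofZLatticeBasis_comap]
    exact this.symm
  rw [himg, measureReal_def, Measure.addHaar_image_continuousLinearMap, ENNReal.toReal_mul,
    ENNReal.toReal_ofReal (abs_nonneg _), measureReal_def]

theorem minNorm_nonneg {k : ℕ} (Λ : Submodule ℤ (EuclideanSpace ℝ (Fin k))) : 0 ≤ minNorm Λ :=
  Real.sInf_nonneg (by rintro _ ⟨x, -, -, rfl⟩; exact norm_nonneg x)

theorem minNorm_le_norm {k : ℕ} {Λ : Submodule ℤ (EuclideanSpace ℝ (Fin k))}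
    {x : EuclideanSpace ℝ (Fin k)} (hx : x ∈ Λ) (hx0 : x ≠ 0) : minNorm Λ ≤ ‖x‖ :=
  csInf_le ⟨0, by rintro _ ⟨x, -, -, rfl⟩; exact norm_nonneg x⟩ ⟨x, hx, hx0, rfl⟩

theorem discreteTopology_of_minNorm_pos {k : ℕ} {Λ : Submodule ℤ (EuclideanSpace ℝ (Fin k))}
    (hΛ : 0 < minNorm Λ) : DiscreteTopology Λ :=
  DiscreteTopology.of_forall_le_dist hΛ fun x y hxy => by
    change minNorm Λ ≤ dist x y
    rw [Subtype.dist_eq, dist_eq_norm]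
    exact minNorm_le_norm (Λ.sub_mem x.2 y.2) fun h => hxy (Subtype.ext (sub_eq_zero.1 h))

open MeasureTheory in
theorem packingDensity_eq {k : ℕ} (hk : 0 < k) (Λ : Submodule ℤ (EuclideanSpace ℝ (Fin k))) :
    packingDensity Λ = (minNorm Λ / 2) ^ k *
      volume.real (Metric.ball (0 : EuclideanSpace ℝ (Fin k)) 1) / ZLattice.covolume Λ := by
  have : Nonempty (Fin k) := ⟨⟨0, hk⟩⟩
  have h := Measure.addHaar_ball (volume : Measure (EuclideanSpace ℝ (Fin k))) 0
    (div_nonneg (minNorm_nonneg Λ) zero_le_two)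
  rw [packingDensity, measureReal_def, h, ENNReal.toReal_mul, ENNReal.toReal_ofReal
    (pow_nonneg (div_nonneg (minNorm_nonneg Λ) zero_le_two) _), measureReal_def]
  simp

theorem latticeImage_one {k : ℕ} (Λ : Submodule ℤ (EuclideanSpace ℝ (Fin k))) :
    latticeImage 1 Λ = Λ := by
  ext x
  simp [latticeImage]

open Filter Topology MeasureTheory in
/-- If `|gΛ|^k ≤ |det g| |Λ|^k` for all `g` close to the identity, then `Λ` is extreme. -/
theorem isExtremeLattice_of_eventually_le_det {k : ℕ} (hk : 0 < k)
    {Λ : Submodule ℤ (EuclideanSpace ℝ (Fin k))} (hΛ : IsLattice Λ)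
    (h : ∀ᶠ g : (EuclideanSpace ℝ (Fin k) →L[ℝ] EuclideanSpace ℝ (Fin k))ˣ in 𝓝 1,
      minNorm (latticeImage g Λ) ^ k ≤
        |LinearMap.det ((g : EuclideanSpace ℝ (Fin k) →L[ℝ] EuclideanSpace ℝ (Fin k)) :
          EuclideanSpace ℝ (Fin k) →ₗ[ℝ] EuclideanSpace ℝ (Fin k))| * minNorm Λ ^ k) :
    IsExtremeLattice Λ := by
  refine ⟨hΛ, ?_⟩
  filter_upwards [h] with g hg
  have := hΛ.1
  have : IsZLattice ℝ Λ := ⟨hΛ.2⟩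
  have hcov : 0 < ZLattice.covolume Λ := ZLattice.covolume_pos Λ
  have hdet : 0 < |LinearMap.det ((g : EuclideanSpace ℝ (Fin k) →L[ℝ] EuclideanSpace ℝ (Fin k)) :
      EuclideanSpace ℝ (Fin k) →ₗ[ℝ] EuclideanSpace ℝ (Fin k))| :=
    abs_pos.2 (ContinuousLinearEquiv.ofUnit g).toLinearEquiv.isUnit_det'.ne_zero
  rw [latticeImage_one, packingDensity_eq hk, packingDensity_eq hk, covolume_latticeImage hΛ,
    div_le_div_iff₀ (mul_pos hdet hcov) hcov, div_pow, div_pow]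
  have hV : 0 ≤ volume.real (Metric.ball (0 : EuclideanSpace ℝ (Fin k)) 1) := measureReal_nonneg
  have := mul_le_mul_of_nonneg_right hg
    (mul_nonneg (mul_nonneg hV hcov.le) (by positivity : (0 : ℝ) ≤ 1 / 2 ^ k))
  refine le_trans (le_of_eq ?_) (this.trans (le_of_eq ?_)) <;> ring

/-! ### The lattice of a maximal equiangular tight frame -/

section Main

variable {n k : ℕ} {f : Fin n → EuclideanSpace ℝ (Fin k)} {γ c : ℝ}

theorem mem_integralSpan (f : Fin n → EuclideanSpace ℝ (Fin k)) (i : Fin n) :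
    f i ∈ integralSpan f :=
  Submodule.subset_span ⟨i, rfl⟩

theorem equiangular_ne_neg (hf1 : ∀ i, ‖f i‖ = 1) (hc1 : c < 1)
    (hc : ∀ i j, i ≠ j → |inner ℝ (f i) (f j)| = c) (i j : Fin n) : f i ≠ -f j := by
  intro h
  by_cases hij : i = j
  · subst hij
    have h0 := congrArg (inner ℝ (f i)) h
    rw [inner_neg_right, real_inner_self_eq_norm_sq, hf1] at h0
    norm_num at h0
  · have := hc i j hij
    rw [h, inner_neg_left, real_inner_self_eq_norm_sq, hf1, abs_neg, one_pow, abs_one] at this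
    exact hc1.ne' this

theorem equiangular_injective (hf1 : ∀ i, ‖f i‖ = 1) (hc1 : c < 1)
    (hc : ∀ i j, i ≠ j → |inner ℝ (f i) (f j)| = c) : Function.Injective f := by
  intro i j h
  by_contra hij
  have := hc i j hij
  rw [h, real_inner_self_eq_norm_sq, hf1, one_pow, abs_one] at this
  exact hc1.ne' this

open Classical in
/-- The vectors `± f i`. -/
noncomputable def signedFrame (f : Fin n → EuclideanSpace ℝ (Fin k)) : Finset (EuclideanSpace ℝ (Fin k)) :=
  Finset.univ.image f ∪ Finset.univ.image fun i => -f i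

theorem mem_signedFrame {x : EuclideanSpace ℝ (Fin k)} :
    x ∈ signedFrame f ↔ ∃ i, x = f i ∨ x = -f i := by
  simp [signedFrame, exists_or, eq_comm]

theorem sum_signedFrame (hf1 : ∀ i, ‖f i‖ = 1) (hc1 : c < 1)
    (hc : ∀ i j, i ≠ j → |inner ℝ (f i) (f j)| = c) (F : EuclideanSpace ℝ (Fin k) → ℝ) :
    ∑ x ∈ signedFrame f, F x = ∑ i, F (f i) + ∑ i, F (-f i) := by
  have hinj := equiangular_injective hf1 hc1 hc
  rw [signedFrame, Finset.sum_union, Finset.sum_image hinj.injOn,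
    Finset.sum_image (g := fun i => -f i) (neg_injective.comp hinj).injOn]
  rw [Finset.disjoint_left]
  intro x hx hx'
  obtain ⟨i, -, rfl⟩ := Finset.mem_image.1 hx
  obtain ⟨j, -, h⟩ := Finset.mem_image.1 hx'
  exact equiangular_ne_neg hf1 hc1 hc i j h.symm

theorem signedFrame_stronglyEutactic (hγ0 : 0 < γ)
    (hγ : ∀ x : EuclideanSpace ℝ (Fin k), ‖x‖ ^ 2 = γ * ∑ i, inner ℝ (f i) x ^ 2)
    (hf1 : ∀ i, ‖f i‖ = 1) (hc1 : c < 1) (hc : ∀ i j, i ≠ j → |inner ℝ (f i) (f j)| = c) :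
    IsStronglyEutacticSet (signedFrame f) := by
  refine ⟨γ / 2, half_pos hγ0, fun y => ?_⟩
  rw [hγ y, sum_signedFrame hf1 hc1 hc, ← Finset.sum_add_distrib, Finset.mul_sum]
  refine Finset.sum_congr rfl fun i _ => ?_
  rw [inner_neg_right, real_inner_comm]
  ring

theorem signedFrame_perfect (hn : 2 * n = k * (k + 1)) (hf1 : ∀ i, ‖f i‖ = 1) (hc0 : 0 < c)
    (hc1 : c < 1) (hc : ∀ i j, i ≠ j → |inner ℝ (f i) (f j)| = c) :
    IsPerfectSet (signedFrame f) := by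
  have hspan : Submodule.span ℝ {A : Matrix (Fin k) (Fin k) ℝ |
      ∃ x ∈ signedFrame f, A = Matrix.vecMulVec x.ofLp x.ofLp} =
        LinearMap.range (symmMatrixOfSym2 k) := by
    apply le_antisymm
    · rw [Submodule.span_le]
      rintro _ ⟨x, -, rfl⟩
      exact mem_range_symmMatrixOfSym2.2 (Matrix.transpose_vecMulVec _ _)
    · rw [← maximalETF_span_vecMulVec hn hf1 hc0 hc1 hc]
      apply Submodule.span_mono
      rintro _ ⟨j, rfl⟩
      exact ⟨f j, mem_signedFrame.2 ⟨j, Or.inl rfl⟩, rfl⟩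
  rw [IsPerfectSet, hspan]
  ext A
  exact mem_range_symmMatrixOfSym2

theorem coe_signedFrame_eq_minVectors (hk : 3 < k) (hn : 2 * n = k * (k + 1))
    (hγ : ∀ x : EuclideanSpace ℝ (Fin k), ‖x‖ ^ 2 = γ * ∑ i, inner ℝ (f i) x ^ 2)
    (hf1 : ∀ i, ‖f i‖ = 1) (hc0 : 0 < c) (hc1 : c < 1)
    (hc : ∀ i j, i ≠ j → |inner ℝ (f i) (f j)| = c) (hmin : minNorm (integralSpan f) = 1) :
    (signedFrame f : Set (EuclideanSpace ℝ (Fin k))) = minVectors (integralSpan f) := by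
  ext x
  rw [Finset.mem_coe, mem_signedFrame, minVectors, Set.mem_ofPred_eq, hmin]
  constructor
  · rintro ⟨i, rfl | rfl⟩
    · exact ⟨mem_integralSpan f i, hf1 i⟩
    · exact ⟨neg_mem (mem_integralSpan f i), by rw [norm_neg, hf1]⟩
  · rintro ⟨hx, hx1⟩
    exact maximalETF_unit_vectors hk hn hγ hf1 hc0 hc1 hc hx hx1

open Filter Topology in
/-- All `g` close to the identity change the norms of the frame vectors, which are minimal, by so
little that Voronoi's determinant inequality applies. -/
theorem maximalETF_extreme (hk : 3 < k) (hn : 2 * n = k * (k + 1)) (hγ0 : 0 < γ)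
    (hγ : ∀ x : EuclideanSpace ℝ (Fin k), ‖x‖ ^ 2 = γ * ∑ i, inner ℝ (f i) x ^ 2)
    (hf1 : ∀ i, ‖f i‖ = 1) (hc0 : 0 < c) (hc1 : c < 1)
    (hc : ∀ i j, i ≠ j → |inner ℝ (f i) (f j)| = c) (hmin : minNorm (integralSpan f) = 1)
    (hΛ : IsLattice (integralSpan f)) : IsExtremeLattice (integralSpan f) := by
  refine isExtremeLattice_of_eventually_le_det (by omega) hΛ ?_
  rw [hmin]
  have hn0 : 0 < n := by
    have : 0 < k * (k + 1) := by positivity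
    omega
  have : Nonempty (Fin n) := ⟨⟨0, hn0⟩⟩
  have hk0 : (0 : ℝ) < k := by exact_mod_cast (by omega : 0 < k)
  have hn0' : (0 : ℝ) < n := by exact_mod_cast hn0
  -- This `ε` solves `2 * k * (n * (2 * ε)) = γ * (1 - ε)`.
  let ε : ℝ := γ / (4 * k * n + γ)
  have hε0 : 0 < ε := by positivity
  have hε : 4 * k * n * ε = γ * (1 - ε) := by
    simp only [ε]
    field_simp
    ring
  have hε1 : 0 < 1 - ε := by
    have : 0 < γ * (1 - ε) := hε ▸ (by positivity)
    exact pos_of_mul_pos_right this hγ0.le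
  have hev : ∀ᶠ g : (EuclideanSpace ℝ (Fin k) →L[ℝ] EuclideanSpace ℝ (Fin k))ˣ in 𝓝 1,
      ∀ i, |‖(g : EuclideanSpace ℝ (Fin k) →L[ℝ] EuclideanSpace ℝ (Fin k)) (f i)‖ ^ 2 - 1| < ε := by
    rw [eventually_all]
    intro i
    have hcont : Continuous fun g : (EuclideanSpace ℝ (Fin k) →L[ℝ] EuclideanSpace ℝ (Fin k))ˣ =>
        |‖(g : EuclideanSpace ℝ (Fin k) →L[ℝ] EuclideanSpace ℝ (Fin k)) (f i)‖ ^ 2 - 1| :=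
      ((((Units.continuous_val).clm_apply continuous_const).norm.pow 2).sub continuous_const).abs
    refine hcont.continuousAt.eventually_lt continuousAt_const ?_
    simpa [hf1] using hε0
  filter_upwards [hev] with g hg
  obtain ⟨i₀, hi₀⟩ := Finite.exists_min fun i =>
    ‖(g : EuclideanSpace ℝ (Fin k) →L[ℝ] EuclideanSpace ℝ (Fin k)) (f i)‖ ^ 2
  have h0 := abs_lt.1 (hg i₀)
  have hμ : 0 < ‖(g : EuclideanSpace ℝ (Fin k) →L[ℝ] EuclideanSpace ℝ (Fin k)) (f i₀)‖ ^ 2 := by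
    linarith
  have hdet := pow_le_det_sq hk hn hγ hf1 hc0 hc1 hc
    (g : EuclideanSpace ℝ (Fin k) →L[ℝ] EuclideanSpace ℝ (Fin k)) hμ hi₀ (by
      have h1 := Finset.sum_le_sum fun i (_ : i ∈ Finset.univ) => (show
        ‖(g : EuclideanSpace ℝ (Fin k) →L[ℝ] EuclideanSpace ℝ (Fin k)) (f i)‖ ^ 2 -
          ‖(g : EuclideanSpace ℝ (Fin k) →L[ℝ] EuclideanSpace ℝ (Fin k)) (f i₀)‖ ^ 2 ≤ 2 * ε by
            linarith [(abs_lt.1 (hg i)).2])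
      rw [Finset.sum_const, Finset.card_univ, Fintype.card_fin, nsmul_eq_mul] at h1
      refine (mul_le_mul_of_nonneg_left h1 (by positivity)).trans ?_
      have h2 : γ * (1 - ε) ≤ γ *
          ‖(g : EuclideanSpace ℝ (Fin k) →L[ℝ] EuclideanSpace ℝ (Fin k)) (f i₀)‖ ^ 2 :=
        mul_le_mul_of_nonneg_left (by linarith) hγ0.le
      linarith)
  have hle : minNorm (latticeImage g (integralSpan f)) ≤
      ‖(g : EuclideanSpace ℝ (Fin k) →L[ℝ] EuclideanSpace ℝ (Fin k)) (f i₀)‖ :=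
    minNorm_le_norm ⟨f i₀, mem_integralSpan f i₀, rfl⟩ fun h => by
      rw [h, norm_zero] at hμ
      simp at hμ
  rw [one_pow, mul_one]
  refine (pow_le_pow_left₀ (minNorm_nonneg _) hle k).trans ((sq_le_sq₀ (by positivity) (abs_nonneg _)).1 ?_)
  rwa [sq_abs, pow_right_comm]

end Main

theorem theorem1p4 (n k : ℕ) (hk : 3 < k) (f : Fin n → EuclideanSpace ℝ (Fin k))
    (hf : IsMaximalUnitETF f) (hmin : minNorm (integralSpan f) = 1) :
    IsLattice (integralSpan f) ∧
      IsPerfectLattice (integralSpan f) ∧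
      IsEutacticLattice (integralSpan f) ∧
      IsStronglyEutacticLattice (integralSpan f) ∧
      IsExtremeLattice (integralSpan f) := by
  obtain ⟨⟨⟨-, hspan, γ, hγ0, hγ⟩, hf1, c, hc0, hc1, hc⟩, hn⟩ := hf
  have hΛ : IsLattice (integralSpan f) :=
    ⟨discreteTopology_of_minNorm_pos (hmin ▸ one_pos),
      top_unique (hspan ▸ Submodule.span_mono Submodule.subset_span)⟩
  have hX := coe_signedFrame_eq_minVectors hk hn hγ hf1 hc0 hc1 hc hmin
  have hse := signedFrame_stronglyEutactic hγ0 hγ hf1 hc1 hc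
  refine ⟨hΛ, ⟨_, hX, signedFrame_perfect hn hf1 hc0 hc1 hc⟩, ⟨_, hX, ?_⟩, ⟨_, hX, hse⟩,
    maximalETF_extreme hk hn hγ0 hγ hf1 hc0 hc1 hc hmin hΛ⟩
  obtain ⟨a, ha, h⟩ := hse
  exact ⟨fun _ => a, fun _ _ => ha, h⟩
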